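/- Let $r>0$, let $X$ be a sequentially complete Hausdorff locally convex space over $\mathbb K\in\{\mathbb R,\mathbb C\}$, and let $(T(t))_{t\ge 0}$ be a strongly continuous, locally equicontinuous semigroup of continuous linear operators on $X$ with generator $(A,D(A))$; that is, $T(0)=\mathrm{id}$, $T(t+s)=T(t)T(s)$, $t\mapsto T(t)x$ is continuous on $[0,\infty)$ for every $x\in X$, and for every continuous seminorm $q$ on $X$ and every $t_0\ge 0$ there are a continuous seminorm $p$ on $X$ and $C\ge 0$ such that $q(T(t)x)\le C\,p(x)$ for all $t\in[0,t_0]$, $x\in X$; and $Ax=\lim_{t\to 0+}\frac{T(t)x-x}{t}$, with $D(A)$ the set of all $x\in X$ for which this limit exists. Suppose that $(T(t))_{t\in[0,r]}$ is of bounded semivariation: for every continuous seminorm $q$ on $X$ there is a continuous seminorm $p$ on $X$ such that $$\sup\Bigl\{q\Bigl(\sum_{i=1}^{n}\bigl(T(d_i)-T(d_{i-1})\bigr)x_i\Bigr)\;:\; n\in\mathbb N,\ 0=d_0<d_1<\dots<d_n=r,\ x_i\in X,\ p(x_i)\le 1\Bigr\}<\infty .$$ Then for every $f\in C([0,r];X)$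 and every $x\in X$ the mild solution $$u(t)=T(t)x+\int_0^t T(t-s)f(s)\,ds,\qquad t\in[0,r],$$ is well defined (the Riemann integrals exist in $X$) and is a classical solution of $$u'(t)=Au(t)+f(t),\quad t\in(0,r],\qquad u(0)=x,$$ that is, $u\in C([0,r];X)\cap C^1((0,r];X)$ (with the one-sided derivative at $t=r$), $u(t)\in D(A)$ for all $t\in(0,r]$, and $u$ satisfies both equations. -/

import Mathlib

open Set Filter Topology
open scoped ENNReal

namespace LCSemigroup

/-- Sequential completeness: every Cauchy sequence converges. -/
def IsSeqComplete (X : Type*) [UniformSpace X] : Prop :=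
  ∀ x : ℕ → X, CauchySeq x → ∃ y : X, Tendsto x atTop (𝓝 y)

/-- `d 0 < d 1 < ⋯ < d n` is a partition of `[a, b]`; the values `d i` with `n < i` play no role. -/
structure IsPartition (a b : ℝ) (n : ℕ) (d : ℕ → ℝ) : Prop where
  left : d 0 = a
  right : d n = b
  lt_succ : ∀ i < n, d i < d (i + 1)

/-! ### Riemann integral -/

section Riemann

variable {X : Type*} [AddCommGroup X] [Module ℝ X] [TopologicalSpace X]

/-- `y` is the Riemann integral of `g` over `[a, b]`: the Riemann sums over tagged partitions
converge to `y` as the mesh tends to `0`. -/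
def HasRiemannIntegral (g : ℝ → X) (a b : ℝ) (y : X) : Prop :=
  ∀ V ∈ 𝓝 y, ∃ δ > 0, ∀ (n : ℕ) (d c : ℕ → ℝ), IsPartition a b n d →
    (∀ i < n, d (i + 1) - d i < δ) → (∀ i < n, c i ∈ Icc (d i) (d (i + 1))) →
    ∑ i ∈ Finset.range n, (d (i + 1) - d i) • g (c i) ∈ V

/-- Riemann integrability over `[a, b]`. -/
def RiemannIntegrable (g : ℝ → X) (a b : ℝ) : Prop :=
  ∃ y : X, HasRiemannIntegral g a b y

open Classical in
/-- The Riemann integral of `g` over `[a, b]` (with the value `0` if it does not exist). -/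
noncomputable def riemannIntegral (g : ℝ → X) (a b : ℝ) : X :=
  if h : RiemannIntegrable g a b then h.choose else 0

theorem exists_partition {a b : ℝ} (hab : a ≤ b) {δ : ℝ} (hδ : 0 < δ) :
    ∃ (n : ℕ) (d : ℕ → ℝ), IsPartition a b n d ∧ ∀ i < n, d (i + 1) - d i < δ := by
  rcases hab.eq_or_lt with rfl | hlt
  · exact ⟨0, fun _ => a, ⟨rfl, rfl, by simp⟩, by simp⟩
  · obtain ⟨n, hn⟩ := exists_nat_gt ((b - a) / δ)
    have hn0 : (0 : ℝ) < n := lt_trans (div_pos (sub_pos.2 hlt) hδ) hn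
    have hs : 0 < (b - a) / n := div_pos (sub_pos.2 hlt) hn0
    refine ⟨n, fun i => a + i * ((b - a) / n), ⟨by simp, ?_, ?_⟩, ?_⟩
    · field_simp
      ring
    · intro i _
      push_cast
      nlinarith
    · intro i _
      have : (b - a) / n < δ := by
        rw [div_lt_iff₀ hδ] at hn
        rw [div_lt_iff₀ hn0]
        linarith
      push_cast
      linarith

/-- The Riemann integral is unique in a Hausdorff space. -/
theorem HasRiemannIntegral.unique [T2Space X] {g : ℝ → X} {a b : ℝ} (hab : a ≤ b) {y z : X}
    (hy : HasRiemannIntegral g a b y) (hz : HasRiemannIntegral g a b z) : y = z := by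
  by_contra hne
  obtain ⟨V, W, hV, hW, hyV, hzW, hVW⟩ := t2_separation hne
  obtain ⟨δ, hδ, h⟩ := hy V (hV.mem_nhds hyV)
  obtain ⟨η, hη, k⟩ := hz W (hW.mem_nhds hzW)
  obtain ⟨n, d, hd, hm⟩ := exists_partition hab (lt_min hδ hη)
  have hc : ∀ i < n, d i ∈ Icc (d i) (d (i + 1)) := fun i hi => ⟨le_rfl, (hd.lt_succ i hi).le⟩
  exact Set.disjoint_left.1 hVW
    (h n d d hd (fun i hi => (hm i hi).trans_le (min_le_left _ _)) hc)
    (k n d d hd (fun i hi => (hm i hi).trans_le (min_le_right _ _)) hc)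

theorem HasRiemannIntegral.riemannIntegral_eq [T2Space X] {g : ℝ → X} {a b : ℝ} (hab : a ≤ b)
    {y : X} (hy : HasRiemannIntegral g a b y) : riemannIntegral g a b = y := by
  have h : RiemannIntegrable g a b := ⟨y, hy⟩
  rw [riemannIntegral, dif_pos h]
  exact h.choose_spec.unique hab hy

end Riemann

/-! ### Bounded semivariation -/

section Semivariation

variable {𝕜 X Y : Type*} [RCLike 𝕜]
  [AddCommGroup X] [Module 𝕜 X] [TopologicalSpace X]
  [AddCommGroup Y] [Module 𝕜 Y] [TopologicalSpace Y]

/-- The semivariation of `α` on `[a, b]` with respect to the seminorms `q` and `p`. -/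
noncomputable def semivariation (q : Seminorm 𝕜 Y) (p : Seminorm 𝕜 X) (α : ℝ → X →L[𝕜] Y)
    (a b : ℝ) : ℝ≥0∞ :=
  ⨆ (n : ℕ) (d : ℕ → ℝ) (_ : IsPartition a b n d) (x : ℕ → X) (_ : ∀ i < n, p (x i) ≤ 1),
    ENNReal.ofReal (q (∑ i ∈ Finset.range n, (α (d (i + 1)) (x i) - α (d i) (x i))))

/-- `α` is of bounded semivariation on `[a, b]`. The fundamental systems of seminorms that are used
consist of all continuous seminorms. -/
def IsBoundedSemivariation (α : ℝ → X →L[𝕜] Y) (a b : ℝ) : Prop :=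
  ∀ q : Seminorm 𝕜 Y, Continuous q →
    ∃ p : Seminorm 𝕜 X, Continuous p ∧ semivariation q p α a b < ∞

end Semivariation

/-! ### Semigroups

A family `(T(t))_{t ≥ 0}` is given by a function on `ℝ` whose values at negative times play no role.
-/

section Semigroup

variable {𝕜 X : Type*} [RCLike 𝕜] [AddCommGroup X] [Module 𝕜 X] [TopologicalSpace X]

/-- The semigroup law. -/
structure IsSemigroup (T : ℝ → X →L[𝕜] X) : Prop where
  zero : T 0 = ContinuousLinearMap.id 𝕜 X
  add : ∀ s t : ℝ, 0 ≤ s → 0 ≤ t → T (t + s) = (T t).comp (T s)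

/-- Strong continuity on `[0, ∞)`. -/
def IsStronglyContinuous (T : ℝ → X →L[𝕜] X) : Prop :=
  ∀ x : X, ContinuousOn (fun t => T t x) (Ici 0)

/-- Local equicontinuity. -/
def IsLocallyEquicontinuous (T : ℝ → X →L[𝕜] X) : Prop :=
  ∀ q : Seminorm 𝕜 X, Continuous q → ∀ t₀ : ℝ, 0 ≤ t₀ →
    ∃ p : Seminorm 𝕜 X, Continuous p ∧ ∃ C : ℝ, 0 ≤ C ∧
      ∀ t ∈ Icc 0 t₀, ∀ x : X, q (T t x) ≤ C * p x

variable [Module ℝ X]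

/-- `y` is the right derivative of `t ↦ T(t)x` at `t = 0`, expressed by difference quotients. -/
def HasOrbitDeriv (T : ℝ → X →L[𝕜] X) (x y : X) : Prop :=
  Tendsto (fun t : ℝ => t⁻¹ • (T t x - x)) (𝓝[>] 0) (𝓝 y)

theorem HasOrbitDeriv.zero (T : ℝ → X →L[𝕜] X) : HasOrbitDeriv T (0 : X) 0 := by
  simpa [HasOrbitDeriv] using tendsto_const_nhds

theorem HasOrbitDeriv.add [IsTopologicalAddGroup X] {T : ℝ → X →L[𝕜] X} {x₁ x₂ y₁ y₂ : X}
    (h₁ : HasOrbitDeriv T x₁ y₁) (h₂ : HasOrbitDeriv T x₂ y₂) :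
    HasOrbitDeriv T (x₁ + x₂) (y₁ + y₂) := by
  refine (Tendsto.add h₁ h₂).congr fun t => ?_
  rw [map_add, ← smul_add]
  congr 1
  abel

theorem HasOrbitDeriv.smul [IsScalarTower ℝ 𝕜 X] [ContinuousSMul 𝕜 X] {T : ℝ → X →L[𝕜] X} (c : 𝕜)
    {x y : X} (h : HasOrbitDeriv T x y) : HasOrbitDeriv T (c • x) (c • y) := by
  refine (Tendsto.const_smul h c).congr fun t => ?_
  rw [map_smul, ← smul_sub, smul_comm]

theorem HasOrbitDeriv.unique [T2Space X] {T : ℝ → X →L[𝕜] X} {x y z : X}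
    (hy : HasOrbitDeriv T x y) (hz : HasOrbitDeriv T x z) : y = z :=
  tendsto_nhds_unique hy hz

/-- The generator `(A, D(A))`: its domain consists of all `x` at which the limit of the difference
quotients exists, and `A x` is that limit. -/
noncomputable def generator [IsScalarTower ℝ 𝕜 X] [IsTopologicalAddGroup X] [ContinuousSMul 𝕜 X]
    [T2Space X] (T : ℝ → X →L[𝕜] X) : X →ₗ.[𝕜] X where
  domain :=
    { carrier := {x | ∃ y, HasOrbitDeriv T x y}
      add_mem' := fun ⟨y, hy⟩ ⟨z, hz⟩ => ⟨y + z, hy.add hz⟩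
      zero_mem' := ⟨0, HasOrbitDeriv.zero T⟩
      smul_mem' := fun c _ ⟨y, hy⟩ => ⟨c • y, hy.smul c⟩ }
  toFun :=
    { toFun := fun x => x.2.choose
      map_add' := fun x y => (x + y).2.choose_spec.unique (x.2.choose_spec.add y.2.choose_spec)
      map_smul' := fun c x => (c • x).2.choose_spec.unique (x.2.choose_spec.smul c) }

theorem mem_generator_domain [IsScalarTower ℝ 𝕜 X] [IsTopologicalAddGroup X] [ContinuousSMul 𝕜 X]
    [T2Space X] {T : ℝ → X →L[𝕜] X} {x : X} :
    x ∈ (generator T).domain ↔ ∃ y, HasOrbitDeriv T x y := Iff.rfl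

theorem hasOrbitDeriv_generator [IsScalarTower ℝ 𝕜 X] [IsTopologicalAddGroup X]
    [ContinuousSMul 𝕜 X] [T2Space X] {T : ℝ → X →L[𝕜] X} (x : (generator T).domain) :
    HasOrbitDeriv T x (generator T x) :=
  Exists.choose_spec (mem_generator_domain.1 x.2)

/-! ### The abstract Cauchy problem -/

/-- The mild solution `t ↦ T(t)x + ∫₀ᵗ T(t - s) f(s) ds`. -/
noncomputable def mildSolution (T : ℝ → X →L[𝕜] X) (f : ℝ → X) (x : X) (t : ℝ) : X :=
  T t x + riemannIntegral (fun s => T (t - s) (f s)) 0 t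

/-- `u` is a classical solution of `u'(t) = A u(t) + f(t)` for `t ∈ (0, r]`, `u(0) = x`, i.e.
`u ∈ C([0, r]; X) ∩ C¹((0, r]; X)`, `u(t) ∈ D(A)` for `t ∈ (0, r]`, and both equations hold.
The derivative at `r` is one-sided. -/
def IsClassicalSolution [ContinuousSMul ℝ X] (A : X →ₗ.[𝕜] X) (r : ℝ) (f : ℝ → X) (x : X)
    (u : ℝ → X) : Prop :=
  ContinuousOn u (Icc 0 r) ∧ u 0 = x ∧
    ∃ u' : ℝ → X, ContinuousOn u' (Ioc 0 r) ∧
      ∀ t ∈ Ioc 0 r, HasDerivWithinAt u (u' t) (Ioc 0 r) t ∧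
        ∃ h : u t ∈ A.domain, u' t = A ⟨u t, h⟩ + f t

end Semigroup

end LCSemigroup

/-! The generator `A` sends `∫ₐᵇ T(s)x ds` to `T(b)x - T(a)x`. Replace `F(t - s)` by a function
piecewise constant in `s`: `A` then maps the integral of `T(s)F(t - s)` over `[0, r]` to the
Stieltjes sum `∑ (T(dᵢ₊₁) - T(dᵢ)) F(t - dᵢ)`. Bounded semivariation makes these sums Cauchy
uniformly in `t` (`uniformCauchySeqOn_stieltjesSum`), and `A` is closed
(`IsGeneratorPair.of_tendsto`), so the limit integral lies in `D(A)` and its image is continuous in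
`t`. Extending `f - f(0)` by zero to the left of `0` gives the same for the convolution `∫₀ᵗ T(t -
s)f(s) ds`.

With `f = T(·)x` the convolution is `t T(t)x`; hence orbits lie in `D(A)` for `t > 0`. So the mild
solution `u` takes values in `D(A)` on `(0, r]` and `Au` is continuous there. Finally `u(t) - u(s) =
∫ₛᵗ T(t - σ)(Au(s) + f(σ)) dσ` for `s ≤ t`, and continuity of the integrand yields `u' = Au + f`
(`hasWeakIntegral_mild_sub`, `hasDerivWithinAt_of_hasWeakIntegral`).

Integrals are handled by testing with real functionals; Hahn–Banach turns the scalar estimates into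
seminorm estimates, and `A w = z` is used in its integrated form `IsGeneratorPair`. -/

namespace LCSemigroup

/-! ### Topology and uniformity in terms of continuous seminorms -/

section Seminorms

variable (𝕜 : Type*) {X : Type*} [RCLike 𝕜] [AddCommGroup X] [Module 𝕜 X]
  [UniformSpace X] [IsUniformAddGroup X]

theorem exists_seminorm_of_mem_nhds [PolynormableSpace 𝕜 X] {y : X} {V : Set X} (hV : V ∈ 𝓝 y) :
    ∃ q : Seminorm 𝕜 X, Continuous q ∧ ∃ ε > 0, ∀ z, q (z - y) < ε → z ∈ V := by
  obtain ⟨s, ε, hε, h⟩ := ((PolynormableSpace.withSeminorms 𝕜 X).mem_nhds_iff y V).1 hV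
  refine ⟨_, ?_, ε, hε, fun z hz => h (Seminorm.mem_ball _ |>.2 hz)⟩
  exact Seminorm.continuous_finsetSup fun i _ => i.2

theorem tendsto_nhds_iff_seminorm [PolynormableSpace 𝕜 X] {ι : Type*} {l : Filter ι}
    {u : ι → X} {y : X} :
    Tendsto u l (𝓝 y) ↔
      ∀ q : Seminorm 𝕜 X, Continuous q → ∀ ε > 0, ∀ᶠ i in l, q (u i - y) < ε := by
  constructor
  · intro h q hq ε hε
    have h1 : Tendsto (fun i => q (u i - y)) l (𝓝 (q (y - y))) :=
      (hq.tendsto _).comp (h.sub_const y)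
    rw [sub_self, map_zero] at h1
    exact h1.eventually_lt_const hε
  · intro h V hV
    obtain ⟨q, hq, ε, hε, hqV⟩ := exists_seminorm_of_mem_nhds 𝕜 hV
    exact (h q hq ε hε).mono fun i hi => hqV _ hi

theorem exists_seminorm_of_mem_uniformity [PolynormableSpace 𝕜 X] {V : Set (X × X)}
    (hV : V ∈ uniformity X) :
    ∃ q : Seminorm 𝕜 X, Continuous q ∧ ∃ ε > 0, ∀ a b, q (a - b) < ε → (a, b) ∈ V := by
  rw [uniformity_eq_comap_nhds_zero X] at hV
  obtain ⟨W, hW, hWV⟩ := hV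
  obtain ⟨q, hq, ε, hε, h⟩ := exists_seminorm_of_mem_nhds 𝕜 hW
  refine ⟨q, hq, ε, hε, fun a b hab => hWV (h _ ?_)⟩
  rwa [sub_zero, map_sub_rev]

theorem cauchySeq_of_seminorm [PolynormableSpace 𝕜 X] {u : ℕ → X}
    (h : ∀ q : Seminorm 𝕜 X, Continuous q → ∀ ε > 0, ∃ N, ∀ m ≥ N, ∀ n ≥ N, q (u m - u n) < ε) :
    CauchySeq u := by
  rw [cauchySeq_iff]
  intro V hV
  obtain ⟨q, hq, ε, hε, hqV⟩ := exists_seminorm_of_mem_uniformity 𝕜 hV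
  obtain ⟨N, hN⟩ := h q hq ε hε
  exact ⟨N, fun m hm n hn => hqV _ _ (hN m hm n hn)⟩

/-- Continuous functions on compact sets are uniformly continuous with respect to each continuous
seminorm. -/
theorem exists_modulus {E : Type*} [PseudoMetricSpace E] {s : Set E} (hs : IsCompact s) {g : E → X}
    (hg : ContinuousOn g s) {q : Seminorm 𝕜 X} (hq : Continuous q) {ε : ℝ} (hε : 0 < ε) :
    ∃ δ > 0, ∀ a ∈ s, ∀ b ∈ s, dist a b < δ → q (g a - g b) < ε := by
  have hu := hs.uniformContinuousOn_of_continuous hg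
  have hV : {p : X × X | q (p.1 - p.2) < ε} ∈ uniformity X := by
    rw [uniformity_eq_comap_nhds_zero X]
    refine ⟨{z | q z < ε}, ?_, fun p hp => ?_⟩
    · exact (isOpen_lt hq continuous_const).mem_nhds (by simpa using hε)
    · simp only [mem_preimage, mem_ofPred_eq] at hp ⊢
      rwa [map_sub_rev]
  have h1 := hu hV
  rw [Filter.mem_map, Metric.uniformity_basis_dist.inf_principal (s ×ˢ s) |>.mem_iff] at h1
  obtain ⟨δ, hδ, h⟩ := h1
  exact ⟨δ, hδ, fun a ha b hb hab => h (show (a, b) ∈ _ from ⟨hab, ha, hb⟩)⟩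

end Seminorms

/-! ### Real functionals dominated by a seminorm -/

section RealFunctionals

variable {𝕜 X : Type*} [RCLike 𝕜] [AddCommGroup X] [Module 𝕜 X] [Module ℝ X] [IsScalarTower ℝ 𝕜 X]

theorem seminorm_real_smul (q : Seminorm 𝕜 X) (c : ℝ) (x : X) : q (c • x) = |c| * q x := by
  rw [← algebraMap_smul 𝕜 c x, map_smul_eq_mul]
  simp

variable [UniformSpace X] [IsUniformAddGroup X]

/-- A continuous seminorm is attained at each point by a real functional that it dominates. -/
theorem exists_dual_le_seminorm (q : Seminorm 𝕜 X) (hq : Continuous q) (x : X) :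
    ∃ φ : X →L[ℝ] ℝ, (∀ z, |φ z| ≤ q z) ∧ φ x = q x := by
  have key : ∃ g : X →ₗ[ℝ] ℝ, g x = q x ∧ ∀ z, g z ≤ q z := by
    -- Well-definedness of `c • x ↦ c * q x` on the line through `x`, which may be trivial.
    have H : ∀ c : ℝ, c • x = 0 → RingHom.id ℝ c • q x = 0 := by
      intro c hc
      have h : |c| * q x = 0 := by rw [← seminorm_real_smul q, hc, map_zero]
      rcases mul_eq_zero.1 h with h | h
      · simp [abs_eq_zero.1 h]
      · simp [h]
    obtain ⟨g, hg, hgq⟩ := exists_extension_of_le_sublinear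
      (LinearPMap.mkSpanSingleton' (σ := RingHom.id ℝ) x (q x) H) q
      (fun c hc z => by rw [seminorm_real_smul, abs_of_pos hc]) (fun y z => map_add_le_add q y z) (by
        rintro ⟨z, hz⟩
        obtain ⟨c, rfl⟩ := Submodule.mem_span_singleton.1 hz
        rw [LinearPMap.mkSpanSingleton'_apply, seminorm_real_smul]
        exact mul_le_mul_of_nonneg_right (le_abs_self c) (apply_nonneg q x))
    refine ⟨g, ?_, hgq⟩
    have := hg ⟨x, Submodule.mem_span_singleton_self x⟩
    rw [this]
    simpa using LinearPMap.mkSpanSingleton'_apply (σ := RingHom.id ℝ) x (q x) H 1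
      (by simp)
  obtain ⟨g, hgx, hgq⟩ := key
  have habs : ∀ z, |g z| ≤ q z := fun z =>
    abs_le.2 ⟨by have := hgq (-z); rw [map_neg, map_neg_eq_map] at this; linarith, hgq z⟩
  have hcont : Continuous g := by
    refine continuous_of_continuousAt_zero g ?_
    rw [ContinuousAt, map_zero]
    refine squeeze_zero_norm (a := fun z => q z) habs ?_
    simpa using hq.tendsto 0
  exact ⟨⟨g, hcont⟩, habs, hgx⟩

variable (𝕜) in
theorem eq_of_forall_dual_eq [PolynormableSpace 𝕜 X] [T2Space X] {y z : X}
    (h : ∀ φ : X →L[ℝ] ℝ, φ y = φ z) : y = z := by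
  -- The constant sequence `y` also converges to `z`, because `q (y - z) = 0` for every continuous
  -- seminorm.
  refine tendsto_nhds_unique (f := fun _ : ℕ => y) (l := atTop) tendsto_const_nhds
    ((tendsto_nhds_iff_seminorm 𝕜).2 fun q hq ε hε => .of_forall fun _ => ?_)
  obtain ⟨φ, -, h2⟩ := exists_dual_le_seminorm q hq (y - z)
  rwa [← h2, map_sub, h, sub_self]

end RealFunctionals

/-! ### Weak integrals -/

section WeakIntegral

variable {X : Type*} [AddCommGroup X] [Module ℝ X] [TopologicalSpace X]

/-- `y` is the integral of `g` over `[a, b]` in the weak sense. -/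
def HasWeakIntegral (g : ℝ → X) (a b : ℝ) (y : X) : Prop :=
  ∀ φ : X →L[ℝ] ℝ, φ y = ∫ s in a..b, φ (g s)

theorem intervalIntegrable_dual (φ : X →L[ℝ] ℝ) {g : ℝ → X} {a b : ℝ} (hab : a ≤ b)
    (hg : ContinuousOn g (Icc a b)) :
    IntervalIntegrable (fun s => φ (g s)) MeasureTheory.volume a b :=
  ContinuousOn.intervalIntegrable_of_Icc hab (φ.continuous.comp_continuousOn hg)

theorem HasWeakIntegral.congr {g g' : ℝ → X} {a b : ℝ} {y : X} (h : HasWeakIntegral g a b y)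
    (hab : a ≤ b) (hgg : ∀ s ∈ Icc a b, g s = g' s) : HasWeakIntegral g' a b y := fun φ => by
  rw [h φ]
  refine intervalIntegral.integral_congr fun s hs => ?_
  rw [uIcc_of_le hab] at hs
  simp only [hgg s hs]

theorem HasWeakIntegral.add {g g' : ℝ → X} {a b : ℝ} {y z : X} (hab : a ≤ b)
    (hg : ContinuousOn g (Icc a b)) (hg' : ContinuousOn g' (Icc a b))
    (h : HasWeakIntegral g a b y) (h' : HasWeakIntegral g' a b z) :
    HasWeakIntegral (fun s => g s + g' s) a b (y + z) := fun φ => by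
  simp only [map_add]
  rw [h φ, h' φ, intervalIntegral.integral_add (intervalIntegrable_dual φ hab hg)
    (intervalIntegrable_dual φ hab hg')]

theorem HasWeakIntegral.sub {g g' : ℝ → X} {a b : ℝ} {y z : X} (hab : a ≤ b)
    (hg : ContinuousOn g (Icc a b)) (hg' : ContinuousOn g' (Icc a b))
    (h : HasWeakIntegral g a b y) (h' : HasWeakIntegral g' a b z) :
    HasWeakIntegral (fun s => g s - g' s) a b (y - z) := fun φ => by
  simp only [map_sub]
  rw [h φ, h' φ, intervalIntegral.integral_sub (intervalIntegrable_dual φ hab hg)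
    (intervalIntegrable_dual φ hab hg')]

theorem HasWeakIntegral.const (a b : ℝ) (c : X) :
    HasWeakIntegral (fun _ => c) a b ((b - a) • c) := fun φ => by
  simp

theorem IsPartition.le {a b : ℝ} {n : ℕ} {d : ℕ → ℝ} (h : IsPartition a b n d) {i j : ℕ}
    (hij : i ≤ j) (hj : j ≤ n) : d i ≤ d j := by
  induction j, hij using Nat.le_induction with
  | base => exact le_rfl
  | succ k _ ih => exact (ih (by omega)).trans (h.lt_succ k (by omega)).le

theorem IsPartition.Icc_subset {a b : ℝ} {n : ℕ} {d : ℕ → ℝ} (h : IsPartition a b n d) {i : ℕ}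
    (hi : i < n) : Icc (d i) (d (i + 1)) ⊆ Icc a b := by
  rw [← h.left, ← h.right]
  exact Icc_subset_Icc (h.le (Nat.zero_le i) hi.le) (h.le hi le_rfl)

/-- A sum of integrals over the pieces of a partition is close to the integral if the integrands
are uniformly close. -/
theorem IsPartition.abs_sum_integral_sub_le {a b : ℝ} {n : ℕ} {d : ℕ → ℝ} (h : IsPartition a b n d)
    {G : ℝ → ℝ} {H : ℕ → ℝ → ℝ} (hG : ContinuousOn G (Icc a b))
    (hH : ∀ i < n, ContinuousOn (H i) (Icc (d i) (d (i + 1)))) {ε : ℝ}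
    (hε : ∀ i < n, ∀ s ∈ Icc (d i) (d (i + 1)), |H i s - G s| ≤ ε) :
    |(∑ i ∈ Finset.range n, ∫ s in d i..d (i + 1), H i s) - ∫ s in a..b, G s| ≤ ε * (b - a) := by
  have hGi : ∀ i < n, IntervalIntegrable G MeasureTheory.volume (d i) (d (i + 1)) := fun i hi =>
    ContinuousOn.intervalIntegrable_of_Icc (h.lt_succ i hi).le (hG.mono (h.Icc_subset hi))
  rw [← h.left, ← h.right, ← intervalIntegral.sum_integral_adjacent_intervals hGi,
    ← Finset.sum_sub_distrib, ← Finset.sum_range_sub d n, Finset.mul_sum]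
  refine (Finset.abs_sum_le_sum_abs _ _).trans (Finset.sum_le_sum fun i hi => ?_)
  rw [Finset.mem_range] at hi
  have hle := (h.lt_succ i hi).le
  rw [← intervalIntegral.integral_sub
    (ContinuousOn.intervalIntegrable_of_Icc hle (hH i hi)) (hGi i hi),
    ← abs_of_nonneg (sub_nonneg.2 hle)]
  refine intervalIntegral.norm_integral_le_of_norm_le_const (E := ℝ) fun s hs => ?_
  rw [uIoc_of_le hle] at hs
  exact hε i hi s (Ioc_subset_Icc_self hs)

theorem abs_dual_riemannSum_sub_le {g : ℝ → X} {a b : ℝ} (hg : ContinuousOn g (Icc a b))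
    (φ : X →L[ℝ] ℝ) {δ ε : ℝ}
    (hδ : ∀ s ∈ Icc a b, ∀ t ∈ Icc a b, dist s t < δ → |φ (g s) - φ (g t)| ≤ ε)
    {n : ℕ} {d c : ℕ → ℝ} (hd : IsPartition a b n d) (hm : ∀ i < n, d (i + 1) - d i < δ)
    (hc : ∀ i < n, c i ∈ Icc (d i) (d (i + 1))) :
    |φ (∑ i ∈ Finset.range n, (d (i + 1) - d i) • g (c i)) - ∫ s in a..b, φ (g s)| ≤
      ε * (b - a) := by
  have := hd.abs_sum_integral_sub_le (H := fun i _ => φ (g (c i)))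
    (φ.continuous.comp_continuousOn hg) (fun i _ => continuousOn_const) (ε := ε)
    (fun i hi s hs => hδ _ (hd.Icc_subset hi (hc i hi)) _ (hd.Icc_subset hi hs) ?_)
  · simpa using this
  · have h1 := hc i hi
    have h2 := hm i hi
    rw [Real.dist_eq, abs_lt]
    constructor <;> linarith [h1.1, h1.2, hs.1, hs.2]

end WeakIntegral

section WeakIntegralLC

variable {𝕜 X : Type*} [RCLike 𝕜] [AddCommGroup X] [Module 𝕜 X] [Module ℝ X] [IsScalarTower ℝ 𝕜 X]
  [UniformSpace X] [IsUniformAddGroup X]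

theorem HasWeakIntegral.seminorm_le {g : ℝ → X} {a b : ℝ} {y : X} (hab : a ≤ b)
    (h : HasWeakIntegral g a b y) {q : Seminorm 𝕜 X} (hq : Continuous q) {C : ℝ}
    (hC : ∀ s ∈ Icc a b, q (g s) ≤ C) : q y ≤ C * (b - a) := by
  obtain ⟨φ, h1, h2⟩ := exists_dual_le_seminorm q hq y
  rw [← h2, h φ, ← abs_of_nonneg (sub_nonneg.2 hab)]
  refine (Real.le_norm_self _).trans
    (intervalIntegral.norm_integral_le_of_norm_le_const fun s hs => ?_)
  rw [uIoc_of_le hab] at hs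
  exact (h1 _).trans (hC s (Ioc_subset_Icc_self hs))

theorem HasWeakIntegral.seminorm_sub_le [ContinuousSMul ℝ X] {g : ℝ → X} {a b : ℝ} {y c : X}
    (hab : a ≤ b) (hg : ContinuousOn g (Icc a b)) (h : HasWeakIntegral g a b y) {q : Seminorm 𝕜 X}
    (hq : Continuous q) {C : ℝ} (hC : ∀ s ∈ Icc a b, q (g s - c) ≤ C) :
    q (y - (b - a) • c) ≤ C * (b - a) :=
  (h.sub hab hg continuousOn_const (.const a b c)).seminorm_le hab hq hC

variable (𝕜)

theorem HasWeakIntegral.hasRiemannIntegral [PolynormableSpace 𝕜 X] {g : ℝ → X} {a b : ℝ}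
    (hg : ContinuousOn g (Icc a b)) {y : X} (hab : a ≤ b) (h : HasWeakIntegral g a b y) :
    HasRiemannIntegral g a b y := by
  intro V hV
  obtain ⟨q, hq, ε, hε, hqV⟩ := exists_seminorm_of_mem_nhds 𝕜 hV
  -- The summand `1` keeps the divisor positive when `a = b`.
  have hpos : 0 < b - a + 1 := by linarith
  obtain ⟨δ, hδ, hmod⟩ := exists_modulus 𝕜 isCompact_Icc hg hq (div_pos hε hpos)
  refine ⟨δ, hδ, fun n d c hd hm hc => hqV _ ?_⟩
  obtain ⟨φ, h1, h2⟩ := exists_dual_le_seminorm q hq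
    ((∑ i ∈ Finset.range n, (d (i + 1) - d i) • g (c i)) - y)
  have h3 := abs_dual_riemannSum_sub_le hg φ (ε := ε / (b - a + 1))
    (fun s hs t ht hst => by
      rw [← map_sub]
      exact (h1 _).trans (hmod s hs t ht hst).le) hd hm hc
  rw [← h φ, ← map_sub, h2, abs_of_nonneg (apply_nonneg q _)] at h3
  refine h3.trans_lt ?_
  rw [div_mul_eq_mul_div, div_lt_iff₀ hpos]
  nlinarith

/-- One sequence of Riemann sums with mesh tending to `0` suffices, hence sequential completeness is
enough. The seminorm of a difference of two sums is attained by a dominated functional, under which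
both sums are close to the same scalar integral; no common refinement is needed. -/
theorem exists_hasWeakIntegral [PolynormableSpace 𝕜 X] (hX : IsSeqComplete X) {g : ℝ → X}
    {a b : ℝ} (hab : a ≤ b) (hg : ContinuousOn g (Icc a b)) : ∃ y, HasWeakIntegral g a b y := by
  have hδ : ∀ k : ℕ, (0 : ℝ) < 1 / (k + 1) := fun k => Nat.one_div_pos_of_nat
  choose n d hd hm using fun k => exists_partition hab (hδ k)
  let S : ℕ → X := fun k => ∑ i ∈ Finset.range (n k), (d k (i + 1) - d k i) • g (d k i)
  have hpos : 0 < b - a + 1 := by linarith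
  have hc : ∀ k, ∀ i < n k, d k i ∈ Icc (d k i) (d k (i + 1)) := fun k i hi =>
    ⟨le_rfl, ((hd k).lt_succ i hi).le⟩
  have hS : ∀ (φ : X →L[ℝ] ℝ) (ε δ : ℝ), 0 < ε →
      (∀ s ∈ Icc a b, ∀ t ∈ Icc a b, dist s t < δ → |φ (g s) - φ (g t)| ≤ ε / (b - a + 1)) →
      ∀ k : ℕ, (1 : ℝ) / (k + 1) < δ → |φ (S k) - ∫ s in a..b, φ (g s)| < ε := by
    intro φ ε δ hε hφ k hk
    refine (abs_dual_riemannSum_sub_le hg φ hφ (hd k)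
      (fun i hi => (hm k i hi).trans hk) (hc k)).trans_lt ?_
    rw [div_mul_eq_mul_div, div_lt_iff₀ hpos]
    nlinarith
  have hlarge : ∀ δ > 0, ∃ N : ℕ, ∀ k ≥ N, (1 : ℝ) / (k + 1) < δ := fun δ hδ =>
    eventually_atTop.1 ((tendsto_one_div_add_atTop_nhds_zero_nat (𝕜 := ℝ)).eventually_lt_const hδ)
  obtain ⟨y, hy⟩ := hX S (cauchySeq_of_seminorm 𝕜 fun q hq ε hε => by
    obtain ⟨δ, hδ, hmod⟩ := exists_modulus 𝕜 isCompact_Icc hg hq (div_pos (half_pos hε) hpos)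
    obtain ⟨N, hN⟩ := hlarge δ hδ
    refine ⟨N, fun k hk l hl => ?_⟩
    obtain ⟨φ, h1, h2⟩ := exists_dual_le_seminorm q hq (S k - S l)
    have h3 := hS φ (ε / 2) δ (half_pos hε) fun s hs t ht hst => by
      rw [← map_sub]
      exact (h1 _).trans (hmod s hs t ht hst).le
    have h4 := abs_lt.1 (h3 k (hN k hk))
    have h5 := abs_lt.1 (h3 l (hN l hl))
    rw [← h2, map_sub]
    linarith)
  refine ⟨y, fun φ => tendsto_nhds_unique ((φ.continuous.tendsto y).comp hy)
    (Metric.tendsto_atTop.2 fun ε hε => ?_)⟩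
  obtain ⟨δ, hδ, hmod⟩ := Metric.uniformContinuousOn_iff.1
    (isCompact_Icc.uniformContinuousOn_of_continuous (φ.continuous.comp_continuousOn hg))
    _ (div_pos hε hpos)
  obtain ⟨N, hN⟩ := hlarge δ hδ
  exact ⟨N, fun k hk => hS φ ε δ hε (fun s hs t ht hst => (hmod s hs t ht hst).le) k (hN k hk)⟩

theorem HasWeakIntegral.riemannIntegral_eq [PolynormableSpace 𝕜 X] [T2Space X] {g : ℝ → X}
    {a b : ℝ} {y : X} (hab : a ≤ b) (hg : ContinuousOn g (Icc a b)) (h : HasWeakIntegral g a b y) :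
    riemannIntegral g a b = y :=
  (h.hasRiemannIntegral 𝕜 hg hab).riemannIntegral_eq hab

end WeakIntegralLC

/-! ### Joint continuity of the semigroup -/

section Orbits

variable {𝕜 X : Type*} [RCLike 𝕜] [AddCommGroup X] [Module 𝕜 X]

theorem IsStronglyContinuous.continuousOn_Icc [TopologicalSpace X] {T : ℝ → X →L[𝕜] X}
    (hTc : IsStronglyContinuous T) (x : X) {a b : ℝ}
    (ha : 0 ≤ a) : ContinuousOn (fun s => T s x) (Icc a b) :=
  (hTc x).mono fun _ hs => ha.trans hs.1

variable [UniformSpace X] [IsUniformAddGroup X]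

/-- Split `T(s)y - T(t)x = T(s)(y - x) + (T(s)x - T(t)x)`: equicontinuity on `[0, t + 1]` controls
the first term, strong continuity the second. -/
theorem continuousOn_semigroup_apply [PolynormableSpace 𝕜 X] {T : ℝ → X →L[𝕜] X}
    (hTc : IsStronglyContinuous T) (hTe : IsLocallyEquicontinuous T) :
    ContinuousOn (fun p : ℝ × X => T p.1 p.2) (Ici 0 ×ˢ univ) := by
  rintro ⟨t, x⟩ ⟨ht, -⟩
  rw [mem_Ici] at ht
  refine (tendsto_nhds_iff_seminorm 𝕜).2 fun q hq ε hε => ?_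
  obtain ⟨p, hp, C, hC, hb⟩ := hTe q hq (t + 1) (by linarith)
  have h1 : Tendsto (fun y : ℝ × X => C * p (y.2 - x) + q (T y.1 x - T t x))
      (𝓝[Ici 0 ×ˢ univ] (t, x)) (𝓝 (C * p (x - x) + q (T t x - T t x))) := by
    refine Tendsto.add (Tendsto.const_mul _ ((hp.tendsto _).comp ?_)) ((hq.tendsto _).comp ?_)
    · exact ((continuous_snd.tendsto (t, x)).mono_left nhdsWithin_le_nhds).sub_const x
    · refine Tendsto.sub_const ?_ _
      refine (hTc x t ht).tendsto.comp (tendsto_nhdsWithin_iff.2 ⟨?_, ?_⟩)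
      · exact (continuous_fst.tendsto (t, x)).mono_left nhdsWithin_le_nhds
      · filter_upwards [self_mem_nhdsWithin] with y hy using hy.1
  simp only [sub_self, map_zero, mul_zero, add_zero] at h1
  have h2 : ∀ᶠ y : ℝ × X in 𝓝[Ici 0 ×ˢ univ] (t, x), y.1 < t + 1 :=
    ((continuous_fst.tendsto (t, x)).mono_left nhdsWithin_le_nhds).eventually_lt_const (by simp)
  filter_upwards [h1.eventually_lt_const hε, h2, self_mem_nhdsWithin] with y hy1 hy2 hy3
  refine lt_of_le_of_lt ?_ hy1
  have : T y.1 y.2 - T t x = T y.1 (y.2 - x) + (T y.1 x - T t x) := by rw [map_sub]; abel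
  rw [this]
  exact (map_add_le_add q _ _).trans (add_le_add_left (hb _ ⟨hy3.1, hy2.le⟩ _) _)

theorem continuousOn_semigroup_comp [PolynormableSpace 𝕜 X] {T : ℝ → X →L[𝕜] X}
    (hTc : IsStronglyContinuous T) (hTe : IsLocallyEquicontinuous T) {E : Type*}
    [TopologicalSpace E] {s : Set E} {τ : E → ℝ} {g : E → X} (hτ : ContinuousOn τ s)
    (hg : ContinuousOn g s) (h0 : ∀ a ∈ s, 0 ≤ τ a) : ContinuousOn (fun a => T (τ a) (g a)) s :=
  (continuousOn_semigroup_apply hTc hTe).comp (hτ.prodMk hg) fun a ha => ⟨h0 a ha, mem_univ _⟩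

end Orbits

/-! ### The generator through integrals -/

section GeneratorPair

variable {𝕜 X : Type*} [RCLike 𝕜] [AddCommGroup X] [Module 𝕜 X] [Module ℝ X]

/-- The integrated form of the relation `A w = z`. -/
def IsGeneratorPair [TopologicalSpace X] (T : ℝ → X →L[𝕜] X) (w z : X) : Prop :=
  ∀ h : ℝ, 0 ≤ h → HasWeakIntegral (fun s => T s z) 0 h (T h w - w)

/-- The composition of a real functional with an operator over `𝕜`. -/
def dualComp [IsScalarTower ℝ 𝕜 X] [TopologicalSpace X] (φ : X →L[ℝ] ℝ) (S : X →L[𝕜] X) :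
    X →L[ℝ] ℝ where
  toFun x := φ (S x)
  map_add' x y := by simp
  map_smul' c x := by
    rw [← algebraMap_smul 𝕜 c x, map_smul, algebraMap_smul, map_smul, RingHom.id_apply]
  cont := φ.continuous.comp S.continuous

theorem map_real_smul [IsScalarTower ℝ 𝕜 X] [TopologicalSpace X] (S : X →L[𝕜] X) (c : ℝ) (x : X) :
    S (c • x) = c • S x := by
  rw [← algebraMap_smul 𝕜 c x, map_smul, algebraMap_smul]

variable [TopologicalSpace X] {T : ℝ → X →L[𝕜] X}

theorem IsStronglyContinuous.intervalIntegrable_dual (hTc : IsStronglyContinuous T)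
    (φ : X →L[ℝ] ℝ) (x : X) {a b : ℝ} (ha : 0 ≤ a) (hb : 0 ≤ b) :
    IntervalIntegrable (fun s => φ (T s x)) MeasureTheory.volume a b := by
  refine ContinuousOn.intervalIntegrable (φ.continuous.comp_continuousOn ((hTc x).mono ?_))
  intro s hs
  exact (le_min ha hb).trans hs.1

theorem IsGeneratorPair.add (hTc : IsStronglyContinuous T) {w₁ w₂ z₁ z₂ : X}
    (h₁ : IsGeneratorPair T w₁ z₁) (h₂ : IsGeneratorPair T w₂ z₂) :
    IsGeneratorPair T (w₁ + w₂) (z₁ + z₂) := fun h hh φ => by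
  have := ((h₁ h hh).add hh (hTc.continuousOn_Icc _ le_rfl) (hTc.continuousOn_Icc _ le_rfl)
    (h₂ h hh)) φ
  simp only [map_add, map_sub] at this ⊢
  linarith

theorem IsGeneratorPair.real_smul [IsScalarTower ℝ 𝕜 X] (c : ℝ) {w z : X}
    (h : IsGeneratorPair T w z) : IsGeneratorPair T (c • w) (c • z) := fun k hk φ => by
  have := h k hk φ
  simp only [map_real_smul, map_smul, map_sub, smul_eq_mul] at this ⊢
  rw [intervalIntegral.integral_const_mul, ← this]
  ring

theorem IsGeneratorPair.zero : IsGeneratorPair T (0 : X) 0 := fun h _ φ => by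
  simp

theorem IsGeneratorPair.sum (hTc : IsStronglyContinuous T) {ι : Type*} (s : Finset ι)
    {w z : ι → X} (h : ∀ i ∈ s, IsGeneratorPair T (w i) (z i)) :
    IsGeneratorPair T (∑ i ∈ s, w i) (∑ i ∈ s, z i) := by
  classical
  induction s using Finset.induction_on with
  | empty => simpa using IsGeneratorPair.zero
  | insert a s ha ih =>
    rw [Finset.sum_insert ha, Finset.sum_insert ha]
    exact (h a (by simp)).add hTc (ih fun i hi => h i (by simp [hi]))

/-- The integral of an orbit over `[a, b]` is mapped to `T(b)x - T(a)x` by the generator. -/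
theorem isGeneratorPair_of_hasWeakIntegral_orbit [IsScalarTower ℝ 𝕜 X] (hT : IsSemigroup T)
    (hTc : IsStronglyContinuous T) {a b : ℝ} (ha : 0 ≤ a) (hab : a ≤ b) {x w : X}
    (hw : HasWeakIntegral (fun s => T s x) a b w) :
    IsGeneratorPair T w (T b x - T a x) := by
  intro h hh φ
  have hb := ha.trans hab
  have e1 : φ (T h w) = ∫ s in a + h..b + h, φ (T s x) := by
    rw [← intervalIntegral.integral_comp_add_right (fun s => φ (T s x))]
    refine (hw (dualComp φ (T h))).trans (intervalIntegral.integral_congr fun s hs => ?_)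
    rw [uIcc_of_le hab] at hs
    simp only [add_comm s h, hT.add s h (ha.trans hs.1) hh]
    rfl
  have e2 : ∀ c, 0 ≤ c → ∫ s in 0..h, φ (T s (T c x)) = ∫ s in c..h + c, φ (T s x) := by
    intro c hc
    have := intervalIntegral.integral_comp_add_right (a := 0) (b := h) (fun s => φ (T s x)) c
    rw [zero_add] at this
    rw [← this]
    refine intervalIntegral.integral_congr fun s hs => ?_
    rw [uIcc_of_le hh] at hs
    simp only [hT.add c s hc hs.1]
    rfl
  simp only [map_sub]
  rw [intervalIntegral.integral_sub (hTc.intervalIntegrable_dual φ _ le_rfl hh)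
    (hTc.intervalIntegrable_dual φ _ le_rfl hh), e1, hw φ, e2 a ha, e2 b hb]
  have hi : ∀ c d, 0 ≤ c → 0 ≤ d → IntervalIntegrable (fun s => φ (T s x))
    MeasureTheory.volume c d := fun c d hc hd => hTc.intervalIntegrable_dual φ x hc hd
  -- Both sides reduce to integrals of one orbit; splitting `[a, b + h]` at `b` and at `a + h`
  -- identifies them.
  have i1 := intervalIntegral.integral_add_adjacent_intervals
    (hi a b ha hb) (hi b (b + h) hb (by linarith))
  have i2 := intervalIntegral.integral_add_adjacent_intervals
    (hi a (a + h) ha (by linarith)) (hi (a + h) (b + h) (by linarith) (by linarith))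
  rw [add_comm h a, add_comm h b]
  linarith

end GeneratorPair

section GeneratorPairLC

variable {𝕜 X : Type*} [RCLike 𝕜] [AddCommGroup X] [Module 𝕜 X] [Module ℝ X] [IsScalarTower ℝ 𝕜 X]
  [UniformSpace X] [IsUniformAddGroup X] [PolynormableSpace 𝕜 X] {T : ℝ → X →L[𝕜] X}

/-- Closedness of the generator: by equicontinuity the orbits of `z n` converge uniformly on `[0,
k]`, so the integrals converge. Only weak convergence of `w n` is asked, which is what approximating
integrands provides. -/
theorem IsGeneratorPair.of_tendsto (hTc : IsStronglyContinuous T)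
    (hTe : IsLocallyEquicontinuous T) {w z : ℕ → X} {w₀ z₀ : X}
    (h : ∀ n, IsGeneratorPair T (w n) (z n))
    (hw : ∀ φ : X →L[ℝ] ℝ, Tendsto (fun n => φ (w n)) atTop (𝓝 (φ w₀)))
    (hz : Tendsto z atTop (𝓝 z₀)) : IsGeneratorPair T w₀ z₀ := by
  intro k hk φ
  have h1 : Tendsto (fun n => φ (T k (w n) - w n)) atTop (𝓝 (φ (T k w₀ - w₀))) := by
    simp only [map_sub]
    exact (hw (dualComp φ (T k))).sub (hw φ)
  refine tendsto_nhds_unique h1 ?_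
  obtain ⟨q, hq, ε, hε, hqV⟩ := exists_seminorm_of_mem_nhds 𝕜
    ((isOpen_lt (φ.continuous.norm) continuous_const).mem_nhds
      (show (0 : X) ∈ {x | ‖φ x‖ < 1} by simp))
  -- Otherwise `x` scaled by `|φ x|⁻¹` lies in the `q`-ball of radius `ε`, where `|φ| < 1`, although
  -- `|φ|` equals `1` there.
  have hφ : ∀ x, |φ x| ≤ ε⁻¹ * q x := by
    intro x
    by_contra! hlt
    have hpos : 0 < |φ x| := lt_of_le_of_lt (by positivity) hlt
    have h2 := hqV (|φ x|⁻¹ • x) (by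
      rw [sub_zero, seminorm_real_smul, abs_inv, abs_abs, inv_mul_lt_iff₀ hpos]
      rwa [inv_mul_lt_iff₀ hε, mul_comm] at hlt)
    rw [mem_ofPred_eq, map_smul, norm_smul, norm_inv, Real.norm_eq_abs, Real.norm_eq_abs, abs_abs,
      inv_mul_cancel₀ hpos.ne'] at h2
    exact lt_irrefl _ h2
  obtain ⟨p, hp, C, hC, hb⟩ := hTe q hq k hk
  rw [tendsto_iff_norm_sub_tendsto_zero]
  have h3 : Tendsto (fun n => ε⁻¹ * (C * p (z n - z₀)) * |k - 0|) atTop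
      (𝓝 (ε⁻¹ * (C * p (z₀ - z₀)) * |k - 0|)) :=
    ((((hp.tendsto _).comp (hz.sub_const z₀)).const_mul C).const_mul _).mul_const _
  rw [sub_self, map_zero, mul_zero, mul_zero, zero_mul] at h3
  refine squeeze_zero (fun _ => norm_nonneg _) (fun n => ?_) h3
  rw [h n k hk φ, ← intervalIntegral.integral_sub
    (hTc.intervalIntegrable_dual φ _ le_rfl hk) (hTc.intervalIntegrable_dual φ _ le_rfl hk)]
  refine intervalIntegral.norm_integral_le_of_norm_le_const fun s hs => ?_
  rw [uIoc_of_le hk] at hs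
  rw [← map_sub, ← map_sub]
  refine (hφ _).trans ?_
  gcongr
  exact hb s (Ioc_subset_Icc_self hs) _

/-- The difference quotient of `w` is the mean of `T(s)z` over `[0, t]`, which tends to `T(0)z = z`.
-/
theorem IsGeneratorPair.hasOrbitDeriv [ContinuousSMul ℝ X] (hT : IsSemigroup T)
    (hTc : IsStronglyContinuous T) {w z : X} (h : IsGeneratorPair T w z) :
    HasOrbitDeriv T w z := by
  refine (tendsto_nhds_iff_seminorm 𝕜).2 fun q hq ε hε => ?_
  have h0 := (tendsto_nhds_iff_seminorm 𝕜).1 (hTc z 0 self_mem_Ici) q hq (ε / 2) (half_pos hε)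
  obtain ⟨δ, hδ, hball⟩ := Metric.mem_nhdsWithin_iff.1 h0
  have h1 : ∀ᶠ t : ℝ in 𝓝[>] 0, t < δ :=
    (tendsto_id.mono_left nhdsWithin_le_nhds).eventually_lt_const hδ
  filter_upwards [self_mem_nhdsWithin, h1] with t (ht : 0 < t) htδ
  have h2 := (h t ht.le).seminorm_sub_le ht.le (hTc.continuousOn_Icc _ le_rfl) hq (c := z)
    (C := ε / 2) fun s hs => by
      have := hball (show s ∈ Metric.ball 0 δ ∩ Ici 0 from
        ⟨by rw [Metric.mem_ball, Real.dist_eq, sub_zero, abs_of_nonneg hs.1]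
            exact hs.2.trans_lt htδ, hs.1⟩)
      simp only [mem_ofPred_eq, hT.zero] at this
      exact this.le
  rw [sub_zero] at h2
  have h3 : t⁻¹ • (T t w - w) - z = t⁻¹ • (T t w - w - t • z) := by
    rw [smul_sub _ _ (t • z), inv_smul_smul₀ ht.ne']
  rw [h3, seminorm_real_smul, abs_inv, abs_of_pos ht, inv_mul_lt_iff₀ ht]
  nlinarith

/-- A function with the integrated increments of a solution is differentiable. -/
theorem hasDerivWithinAt_of_hasWeakIntegral [ContinuousSMul ℝ X] (hT : IsSemigroup T)
    (hTc : IsStronglyContinuous T) (hTe : IsLocallyEquicontinuous T) {S : Set ℝ}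
    (hS : S.OrdConnected) {u Z f : ℝ → X} (hZ : ContinuousOn Z S) (hf : ContinuousOn f S)
    (hu : ∀ s ∈ S, ∀ t ∈ S, s ≤ t →
      HasWeakIntegral (fun σ => T (t - σ) (Z s + f σ)) s t (u t - u s))
    {t₀ : ℝ} (ht₀ : t₀ ∈ S) : HasDerivWithinAt u (Z t₀ + f t₀) S t₀ := by
  set c := Z t₀ + f t₀ with hc
  have key : ∀ q : Seminorm 𝕜 X, Continuous q → ∀ ε > 0, ∃ δ > 0, ∀ t ∈ S, |t - t₀| < δ →
      q (u t - u t₀ - (t - t₀) • c) ≤ ε * |t - t₀| := by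
    intro q hq ε hε
    -- Elapsed time, left endpoint and integration variable vary independently, so one estimate
    -- covers increments on either side of `t₀`.
    have hK : ContinuousOn (fun y : ℝ × ℝ × ℝ => T y.1 (Z y.2.1 + f y.2.2)) (Ici 0 ×ˢ S ×ˢ S) :=
      continuousOn_semigroup_comp hTc hTe continuousOn_fst
        ((hZ.comp (by fun_prop) fun y hy => hy.2.1).add
          (hf.comp (by fun_prop) fun y hy => hy.2.2)) fun y hy => hy.1
    have h0 := (tendsto_nhds_iff_seminorm 𝕜).1
      (hK (0, t₀, t₀) ⟨self_mem_Ici, ht₀, ht₀⟩) q hq ε hε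
    obtain ⟨δ, hδ, hball⟩ := Metric.mem_nhdsWithin_iff.1 h0
    have hclose : ∀ s ∈ S, ∀ t ∈ S, s ≤ t → |s - t₀| < δ → t - s < δ → |t - t₀| < δ →
        q (u t - u s - (t - s) • c) ≤ ε * (t - s) := by
      intro s hs t ht hst hsδ htsδ htδ
      refine (hu s hs t ht hst).seminorm_sub_le hst ?_ hq fun σ hσ => ?_
      · exact continuousOn_semigroup_comp hTc hTe (by fun_prop)
          (continuousOn_const.add (hf.mono (hS.out hs ht))) fun σ hσ => sub_nonneg.2 hσ.2
      · have := hball (show (t - σ, s, σ) ∈ Metric.ball (0, t₀, t₀) δ ∩ Ici 0 ×ˢ S ×ˢ S from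
          ⟨by
            rw [Metric.mem_ball, Prod.dist_eq, Prod.dist_eq, Real.dist_eq, Real.dist_eq,
              Real.dist_eq, sub_zero]
            rw [abs_lt] at hsδ htδ
            refine max_lt (abs_lt.2 ?_) (max_lt (abs_lt.2 ?_) (abs_lt.2 ?_)) <;>
              constructor <;> linarith [hσ.1, hσ.2],
            sub_nonneg.2 hσ.2, hs, hS.out hs ht hσ⟩)
        simp only [mem_ofPred_eq, hT.zero] at this
        exact this.le
    refine ⟨δ, hδ, fun t ht htδ => ?_⟩
    rcases le_total t₀ t with hle | hle
    · rw [abs_of_nonneg (sub_nonneg.2 hle)] at htδ ⊢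
      exact hclose t₀ ht₀ t ht hle (by simpa using hδ) htδ
        (by rwa [abs_of_nonneg (sub_nonneg.2 hle)])
    · have h1 := hclose t ht t₀ ht₀ hle htδ (by
        rwa [abs_sub_comm, abs_of_nonneg (sub_nonneg.2 hle)] at htδ) (by simpa using hδ)
      rw [abs_sub_comm, abs_of_nonneg (sub_nonneg.2 hle)]
      refine le_trans (le_of_eq ?_) h1
      rw [← map_neg_eq_map q]
      congr 1
      rw [← neg_sub t₀ t, neg_smul]
      abel
  refine .of_isLittleOTVS ?_
  rw [Asymptotics.isLittleOTVS_iff_tendsto_inv_smul]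
  · refine (tendsto_nhds_iff_seminorm 𝕜).2 fun q hq ε hε => ?_
    obtain ⟨δ, hδ, h⟩ := key q hq (ε / 2) (half_pos hε)
    rw [prod_pure, eventually_map]
    filter_upwards [self_mem_nhdsWithin, mem_nhdsWithin_of_mem_nhds (Metric.ball_mem_nhds t₀ hδ)]
      with t ht htδ
    rw [Metric.mem_ball, Real.dist_eq] at htδ
    have h1 := h t ht htδ
    simp only [ContinuousLinearMap.toSpanSingleton_apply, sub_zero]
    rw [seminorm_real_smul, abs_inv]
    -- The filter includes `t₀` itself; there the factor is `0⁻¹ = 0`.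
    rcases eq_or_ne t t₀ with rfl | hne
    · simpa using hε
    · have hpos : 0 < |t - t₀| := abs_pos.2 (sub_ne_zero.2 hne)
      rw [inv_mul_lt_iff₀ hpos]
      nlinarith
  · refine .of_forall fun y hy => ?_
    rw [sub_eq_zero] at hy
    simp [hy]

end GeneratorPairLC

/-! ### Stieltjes sums over uniform partitions -/

/-- The `i`-th node of the uniform partition of `[0, r]` into `N` pieces. -/
noncomputable def uniformNode (r : ℝ) (N i : ℕ) : ℝ := i * r / N

theorem isPartition_uniformNode {r : ℝ} (hr : 0 < r) {N : ℕ} (hN : 0 < N) :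
    IsPartition 0 r N (uniformNode r N) := by
  have hN' : (0 : ℝ) < N := Nat.cast_pos.2 hN
  refine ⟨by simp [uniformNode], by rw [uniformNode]; field_simp, fun i _ => ?_⟩
  unfold uniformNode
  gcongr
  simp

theorem uniformNode_succ_sub (r : ℝ) (N i : ℕ) :
    uniformNode r N (i + 1) - uniformNode r N i = r / N := by
  unfold uniformNode
  push_cast
  ring

theorem uniformNode_mul (r : ℝ) (N i : ℕ) {m : ℕ} (hm : 0 < m) :
    uniformNode r (N * m) (i * m) = uniformNode r N i := by
  have hm' : (m : ℝ) ≠ 0 := by positivity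
  unfold uniformNode
  push_cast
  rw [mul_right_comm, mul_div_mul_right _ _ hm']

theorem uniformNode_mem_Icc {r : ℝ} (hr : 0 < r) {N i : ℕ} (hN : 0 < N) (hi : i ≤ N) :
    uniformNode r N i ∈ Icc 0 r := by
  have h := isPartition_uniformNode hr hN
  constructor
  · rw [← h.left]
    exact h.le (Nat.zero_le i) hi
  · conv_rhs => rw [← h.right]
    exact h.le hi le_rfl

/-- With integer division, `j / m` indexes the last coarse node at or before the fine node `j`. -/
theorem abs_uniformNode_div_sub_le {r : ℝ} (hr : 0 < r) {N m : ℕ} (hN : 0 < N) (hm : 0 < m)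
    (j : ℕ) : |uniformNode r N (j / m) - uniformNode r (N * m) j| ≤ r / N := by
  have hN' : (0 : ℝ) < N := Nat.cast_pos.2 hN
  have hm' : (0 : ℝ) < m := Nat.cast_pos.2 hm
  have h1 : (j : ℝ) = m * (j / m : ℕ) + (j % m : ℕ) := by exact_mod_cast (Nat.div_add_mod j m).symm
  have h2 : ((j % m : ℕ) : ℝ) ≤ m := by exact_mod_cast (Nat.mod_lt j hm).le
  have h3 : uniformNode r N (j / m) - uniformNode r (N * m) j =
      -(((j % m : ℕ) : ℝ) / m * (r / N)) := by
    unfold uniformNode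
    push_cast
    rw [h1]
    field_simp
    simp
  rw [h3, abs_neg, abs_of_nonneg (by positivity)]
  refine mul_le_of_le_one_left (by positivity) ?_
  rwa [div_le_one hm']

theorem sum_range_mul_eq {M : Type*} [AddCommMonoid M] (h : ℕ → M) (N m : ℕ) :
    ∑ j ∈ Finset.range (N * m), h j =
      ∑ i ∈ Finset.range N, ∑ k ∈ Finset.range m, h (i * m + k) := by
  induction N with
  | zero => simp
  | succ N ih => rw [Nat.succ_mul, Finset.sum_range_add, ih, Finset.sum_range_succ]

section Stieltjes

variable {𝕜 X : Type*} [RCLike 𝕜] [AddCommGroup X] [Module 𝕜 X] [TopologicalSpace X]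

/-- The Stieltjes sum of `y` with respect to `T` over the uniform partition of `[0, r]`. -/
noncomputable def stieltjesSum (T : ℝ → X →L[𝕜] X) (r : ℝ) (N : ℕ) (y : ℕ → X) : X :=
  ∑ i ∈ Finset.range N, (T (uniformNode r N (i + 1)) (y i) - T (uniformNode r N i) (y i))

/-- The vector is constant on each coarse interval, so the fine increments of `T` telescope. -/
theorem stieltjesSum_refine (T : ℝ → X →L[𝕜] X) (r : ℝ) (N : ℕ) {m : ℕ} (hm : 0 < m)
    (y : ℕ → X) : stieltjesSum T r N y = stieltjesSum T r (N * m) fun j => y (j / m) := by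
  unfold stieltjesSum
  rw [sum_range_mul_eq]
  refine Finset.sum_congr rfl fun i _ => ?_
  have h : ∀ k ∈ Finset.range m, T (uniformNode r (N * m) (i * m + k + 1)) (y ((i * m + k) / m)) -
      T (uniformNode r (N * m) (i * m + k)) (y ((i * m + k) / m)) =
      T (uniformNode r (N * m) (i * m + (k + 1))) (y i) -
      T (uniformNode r (N * m) (i * m + k)) (y i) := by
    intro k hk
    rw [Finset.mem_range] at hk
    have : (i * m + k) / m = i := by
      rw [mul_comm, Nat.mul_add_div hm, Nat.div_eq_of_lt hk, add_zero]
    rw [this, add_assoc]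
  rw [Finset.sum_congr rfl h,
    Finset.sum_range_sub fun k => T (uniformNode r (N * m) (i * m + k)) (y i), add_zero,
    uniformNode_mul r N i hm, ← Nat.succ_mul, uniformNode_mul r N _ hm]

variable [Module ℝ X] [IsScalarTower ℝ 𝕜 X]

/-- Homogeneity: scaling by `K⁻¹` reduces to vectors in the unit ball of `p`. -/
theorem exists_bound_of_semivariation_lt_top {T : ℝ → X →L[𝕜] X} {a b : ℝ} {q p : Seminorm 𝕜 X}
    (h : semivariation q p T a b < ∞) : ∃ M : ℝ, 0 ≤ M ∧ ∀ n d, IsPartition a b n d →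
      ∀ (x : ℕ → X) (K : ℝ), 0 < K → (∀ i < n, p (x i) ≤ K) →
        q (∑ i ∈ Finset.range n, (T (d (i + 1)) (x i) - T (d i) (x i))) ≤ M * K := by
  refine ⟨(semivariation q p T a b).toReal, ENNReal.toReal_nonneg, fun n d hd x K hK hx => ?_⟩
  have h1 : ENNReal.ofReal (q (∑ i ∈ Finset.range n,
      (T (d (i + 1)) (K⁻¹ • x i) - T (d i) (K⁻¹ • x i)))) ≤ semivariation q p T a b := by
    refine le_iSup_of_le n (le_iSup_of_le d (le_iSup_of_le hd
      (le_iSup_of_le (fun i => K⁻¹ • x i) (le_iSup_of_le (fun i hi => ?_) le_rfl))))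
    rw [seminorm_real_smul, abs_inv, abs_of_pos hK, inv_mul_le_iff₀ hK, mul_one]
    exact hx i hi
  rw [ENNReal.ofReal_le_iff_le_toReal h.ne] at h1
  simp only [map_real_smul, ← smul_sub, ← Finset.smul_sum] at h1
  rwa [seminorm_real_smul, abs_inv, abs_of_pos hK, inv_mul_le_iff₀ hK, mul_comm] at h1

end Stieltjes

/-! ### Convolutions, orbits and mild solutions under bounded semivariation -/

section Convolution

variable {𝕜 X : Type*} [RCLike 𝕜] [AddCommGroup X] [Module 𝕜 X] [Module ℝ X]
  [UniformSpace X] [IsUniformAddGroup X] [PolynormableSpace 𝕜 X] {T : ℝ → X →L[𝕜] X} {r : ℝ}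

/-- Freezing `F(t - ·)` at the left node of each piece costs little, since `φ(T(s)F(t - s'))` is
uniformly continuous on the square in `(s, s')`. -/
theorem tendsto_sum_dual_pieces (hr : 0 < r) (hTc : IsStronglyContinuous T)
    (hTe : IsLocallyEquicontinuous T) {F : ℝ → X} (hF : Continuous F) (φ : X →L[ℝ] ℝ) (t : ℝ) :
    Tendsto (fun k : ℕ => ∑ i ∈ Finset.range (k + 1),
      ∫ s in uniformNode r (k + 1) i..uniformNode r (k + 1) (i + 1),
        φ (T s (F (t - uniformNode r (k + 1) i)))) atTop
      (𝓝 (∫ s in 0..r, φ (T s (F (t - s))))) := by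
  have hH : ContinuousOn (fun y : ℝ × ℝ => φ (T y.1 (F (t - y.2)))) (Icc 0 r ×ˢ Icc 0 r) :=
    φ.continuous.comp_continuousOn (continuousOn_semigroup_comp hTc hTe continuousOn_fst
      (hF.comp (by fun_prop)).continuousOn fun y hy => hy.1.1)
  rw [Metric.tendsto_atTop]
  intro ε hε
  have hη : 0 < ε / (r + 1) := by positivity
  obtain ⟨δ, hδ, hmod⟩ := Metric.uniformContinuousOn_iff.1
    ((isCompact_Icc.prod isCompact_Icc).uniformContinuousOn_of_continuous hH) _ hη
  have hlim : Tendsto (fun k : ℕ => r / ((k + 1 : ℕ) : ℝ)) atTop (𝓝 0) :=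
    (tendsto_const_div_atTop_nhds_zero_nat r).comp (tendsto_add_atTop_nat 1)
  obtain ⟨K, hK⟩ := eventually_atTop.1 (hlim.eventually_lt_const hδ)
  refine ⟨K, fun k hk => ?_⟩
  have hd := isPartition_uniformNode hr (Nat.succ_pos k)
  have h1 := hd.abs_sum_integral_sub_le (G := fun s => φ (T s (F (t - s))))
    (H := fun i s => φ (T s (F (t - uniformNode r (k + 1) i)))) (ε := ε / (r + 1))
    (hH.comp (f := fun s : ℝ => (s, s)) (by fun_prop) fun s hs => ⟨hs, hs⟩)
    (fun i hi => hH.comp (f := fun s : ℝ => (s, uniformNode r (k + 1) i)) (by fun_prop)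
      fun s hs => ⟨hd.Icc_subset hi hs, uniformNode_mem_Icc hr (Nat.succ_pos k) hi.le⟩)
    fun i hi s hs => by
      have hs' := hd.Icc_subset hi hs
      refine (hmod (s, uniformNode r (k + 1) i)
        ⟨hs', uniformNode_mem_Icc hr (Nat.succ_pos k) hi.le⟩ (s, s) ⟨hs', hs'⟩ ?_).le
      rw [Prod.dist_eq, dist_self, Real.dist_eq, abs_sub_comm, abs_of_nonneg (sub_nonneg.2 hs.1)]
      refine max_lt hδ (lt_of_le_of_lt ?_ (hK k hk))
      rw [← uniformNode_succ_sub r (k + 1) i]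
      exact sub_le_sub_right hs.2 _
  rw [Real.dist_eq]
  refine h1.trans_lt ?_
  rw [sub_zero, div_mul_eq_mul_div, div_lt_iff₀ (by positivity)]
  nlinarith

variable [IsScalarTower ℝ 𝕜 X]

theorem sub_uniformNode_mem {t : ℝ} (hr : 0 < r) (ht : t ∈ Icc 0 r) {N i : ℕ} (hN : 0 < N)
    (hi : i ≤ N) : t - uniformNode r N i ∈ Icc (-r) r := by
  have := uniformNode_mem_Icc hr hN hi
  constructor <;> linarith [this.1, this.2, ht.1, ht.2]

/-- The Stieltjes sums of the translates of a continuous function are uniformly Cauchy. -/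
theorem uniformCauchySeqOn_stieltjesSum (hr : 0 < r) (hsv : IsBoundedSemivariation T 0 r)
    {F : ℝ → X} (hF : Continuous F) :
    UniformCauchySeqOn
      (fun k t => stieltjesSum T r (k + 1) fun i => F (t - uniformNode r (k + 1) i))
      atTop (Icc 0 r) := by
  intro V hV
  obtain ⟨q, hq, ε, hε, hqV⟩ := exists_seminorm_of_mem_uniformity 𝕜 hV
  obtain ⟨p, hp, hpq⟩ := hsv q hq
  obtain ⟨M, hM, hb⟩ := exists_bound_of_semivariation_lt_top hpq
  have hη : 0 < ε / (2 * (M + 1)) := by positivity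
  -- All arguments `t - dᵢ` stay in `[-r, r]`, so `δ` is independent of `t`.
  obtain ⟨δ, hδ, hmod⟩ := exists_modulus 𝕜 (isCompact_Icc (a := -r) (b := r)) hF.continuousOn hp hη
  have hcmp : ∀ N m : ℕ, 0 < N → 0 < m → r / N < δ → ∀ t ∈ Icc 0 r,
      q (stieltjesSum T r N (fun i => F (t - uniformNode r N i)) -
        stieltjesSum T r (N * m) fun i => F (t - uniformNode r (N * m) i)) < ε / 2 := by
    intro N m hN hm hNδ t ht
    have hNm := Nat.mul_pos hN hm
    rw [stieltjesSum_refine T r N hm]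
    have h1 := hb (N * m) _ (isPartition_uniformNode hr hNm)
      (fun j => F (t - uniformNode r N (j / m)) - F (t - uniformNode r (N * m) j)) _ hη
      fun j hj => by
        refine (hmod _ (sub_uniformNode_mem hr ht hN (Nat.div_le_of_le_mul ?_)) _
          (sub_uniformNode_mem hr ht hNm hj.le) ?_).le
        · rw [mul_comm]; exact hj.le
        · rw [Real.dist_eq, sub_sub_sub_cancel_left, abs_sub_comm]
          exact (abs_uniformNode_div_sub_le hr hN hm j).trans_lt hNδ
    have h2 : stieltjesSum T r (N * m) (fun j => F (t - uniformNode r N (j / m))) -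
        stieltjesSum T r (N * m) (fun i => F (t - uniformNode r (N * m) i)) =
        ∑ j ∈ Finset.range (N * m), (T (uniformNode r (N * m) (j + 1))
          (F (t - uniformNode r N (j / m)) - F (t - uniformNode r (N * m) j)) -
          T (uniformNode r (N * m) j)
          (F (t - uniformNode r N (j / m)) - F (t - uniformNode r (N * m) j))) := by
      unfold stieltjesSum
      rw [← Finset.sum_sub_distrib]
      refine Finset.sum_congr rfl fun j _ => ?_
      simp only [map_sub]
      abel
    rw [h2]
    refine h1.trans_lt ?_
    rw [mul_div_assoc', div_lt_div_iff₀ (by positivity) two_pos]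
    nlinarith
  have hlim : Tendsto (fun k : ℕ => r / ((k + 1 : ℕ) : ℝ)) atTop (𝓝 0) :=
    (tendsto_const_div_atTop_nhds_zero_nat r).comp (tendsto_add_atTop_nat 1)
  obtain ⟨K, hK⟩ := eventually_atTop.1 (hlim.eventually_lt_const hδ)
  have hmem : ∀ᶠ m : ℕ × ℕ in atTop ×ˢ atTop, K ≤ m.1 ∧ K ≤ m.2 :=
    (eventually_ge_atTop K).prod_mk (eventually_ge_atTop K)
  filter_upwards [hmem] with m hm t ht
  refine hqV _ _ ?_
  -- Both partitions are compared with their common refinement into `(m.1 + 1) * (m.2 + 1)` pieces.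
  have h1 := hcmp (m.1 + 1) (m.2 + 1) (Nat.succ_pos _) (Nat.succ_pos _) (hK _ hm.1) t ht
  have h2 := hcmp (m.2 + 1) (m.1 + 1) (Nat.succ_pos _) (Nat.succ_pos _) (hK _ hm.2) t ht
  rw [mul_comm (m.2 + 1), map_sub_rev] at h2
  have h3 := (map_add_le_add q _ _).trans_lt (add_lt_add h1 h2)
  rwa [sub_add_sub_cancel, add_halves] at h3

/-- The generator applied to the integrals of `s ↦ T(s) F(t - s)` over `[0, r]`. -/
theorem exists_generatorPair_of_continuous (hX : IsSeqComplete X) (hr : 0 < r)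
    (hT : IsSemigroup T) (hTc : IsStronglyContinuous T) (hTe : IsLocallyEquicontinuous T)
    (hsv : IsBoundedSemivariation T 0 r) {F : ℝ → X} (hF : Continuous F) :
    ∃ z : ℝ → X, ContinuousOn z (Icc 0 r) ∧ ∀ t ∈ Icc 0 r, ∀ v : X,
      HasWeakIntegral (fun s => T s (F (t - s))) 0 r v → IsGeneratorPair T v (z t) := by
  let Z : ℕ → ℝ → X := fun k t =>
    stieltjesSum T r (k + 1) fun i => F (t - uniformNode r (k + 1) i)
  have hC : UniformCauchySeqOn Z atTop (Icc 0 r) := uniformCauchySeqOn_stieltjesSum hr hsv hF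
  have hlim : ∀ t : ℝ, ∃ y, t ∈ Icc 0 r → Tendsto (fun k => Z k t) atTop (𝓝 y) := fun t => by
    by_cases ht : t ∈ Icc 0 r
    · obtain ⟨y, hy⟩ := hX _ (hC.cauchySeq ht)
      exact ⟨y, fun _ => hy⟩
    · exact ⟨0, fun h => absurd h ht⟩
  choose z hz using hlim
  have hZc : ∀ k, Continuous (Z k) := fun k => continuous_finsetSum _ fun i _ =>
    ((T _).continuous.comp (hF.comp (by fun_prop))).sub
      ((T _).continuous.comp (hF.comp (by fun_prop)))
  refine ⟨z, (hC.tendstoUniformlyOn_of_tendsto hz).continuousOn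
    (.of_forall fun k => (hZc k).continuousOn), fun t ht v hv => ?_⟩
  have hw : ∀ (k i : ℕ), ∃ w, i < k + 1 → HasWeakIntegral
      (fun s => T s (F (t - uniformNode r (k + 1) i)))
      (uniformNode r (k + 1) i) (uniformNode r (k + 1) (i + 1)) w := by
    intro k i
    by_cases hi : i < k + 1
    · obtain ⟨w, hw⟩ := exists_hasWeakIntegral 𝕜 hX
        ((isPartition_uniformNode hr (Nat.succ_pos k)).lt_succ i hi).le
        (hTc.continuousOn_Icc (F (t - uniformNode r (k + 1) i))
          (uniformNode_mem_Icc hr (Nat.succ_pos k) hi.le).1)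
      exact ⟨w, fun _ => hw⟩
    · exact ⟨0, fun h => absurd h hi⟩
  choose w hw using hw
  refine IsGeneratorPair.of_tendsto hTc hTe (w := fun k => ∑ i ∈ Finset.range (k + 1), w k i)
    (fun k => .sum hTc _ fun i hi => ?_) (fun φ => ?_) (hz t ht)
  · rw [Finset.mem_range] at hi
    exact isGeneratorPair_of_hasWeakIntegral_orbit hT hTc
      (uniformNode_mem_Icc hr (Nat.succ_pos k) hi.le).1
      ((isPartition_uniformNode hr (Nat.succ_pos k)).lt_succ i hi).le (hw k i hi)
  · rw [hv φ]
    refine (tendsto_sum_dual_pieces hr hTc hTe hF φ t).congr fun k => ?_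
    rw [map_sum]
    exact Finset.sum_congr rfl fun i hi => (hw k i (Finset.mem_range.1 hi) φ).symm

/-- The generator applied to the convolution of the semigroup with a continuous function. -/
theorem exists_generatorPair_convolution [ContinuousSMul ℝ X] (hX : IsSeqComplete X) (hr : 0 < r)
    (hT : IsSemigroup T) (hTc : IsStronglyContinuous T) (hTe : IsLocallyEquicontinuous T)
    (hsv : IsBoundedSemivariation T 0 r) {f : ℝ → X} (hf : ContinuousOn f (Icc 0 r)) :
    ∃ z : ℝ → X, ContinuousOn z (Icc 0 r) ∧ ∀ t ∈ Icc 0 r, ∀ v : X,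
      HasWeakIntegral (fun s => T (t - s) (f s)) 0 t v → IsGeneratorPair T v (z t) := by
  -- Subtracting `f 0` lets the extension vanish continuously on `(-∞, 0]`, so that `T(s)F(t - s)`
  -- contributes nothing for `s ≥ t`. The removed constant adds an orbit integral, with image
  -- `T(t)f(0) - T(0)f(0)`.
  let F : ℝ → X := fun s => f (max 0 (min r s)) - f 0
  have hF : Continuous F := (hf.comp_continuous (by fun_prop)
    fun s => ⟨le_max_left _ _, max_le hr.le (min_le_left _ _)⟩).sub continuous_const
  obtain ⟨z, hz, hzv⟩ := exists_generatorPair_of_continuous hX hr hT hTc hTe hsv hF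
  refine ⟨fun t => z t + (T t (f 0) - T 0 (f 0)), hz.add
    ((hTc.continuousOn_Icc _ le_rfl).sub continuousOn_const), fun t ht v hv => ?_⟩
  obtain ⟨w, hw⟩ := exists_hasWeakIntegral 𝕜 hX ht.1 (hTc.continuousOn_Icc (f 0) le_rfl)
  rw [← sub_add_cancel v w]
  refine (hzv t ht (v - w) fun φ => ?_).add hTc
    (isGeneratorPair_of_hasWeakIntegral_orbit hT hTc le_rfl ht.1 hw)
  have hcont : ContinuousOn (fun s => T s (F (t - s))) (Icc 0 r) :=
    continuousOn_semigroup_comp hTc hTe continuousOn_id (hF.comp (by fun_prop)).continuousOn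
      fun s hs => hs.1
  have e1 : ∫ s in t..r, φ (T s (F (t - s))) = 0 := by
    rw [intervalIntegral.integral_congr (g := fun _ => (0 : ℝ)) fun s hs => ?_]
    · simp
    · rw [uIcc_of_le ht.2] at hs
      have : max 0 (min r (t - s)) = 0 :=
        max_eq_left ((min_le_right _ _).trans (sub_nonpos.2 hs.1))
      simp [F, this]
  have e2 : ∫ s in 0..t, φ (T (t - s) (f s)) = ∫ s in 0..t, φ (T s (f (t - s))) := by
    have := intervalIntegral.integral_comp_sub_left (a := 0) (b := t)
      (fun s => φ (T s (f (t - s)))) t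
    simpa using this
  have hconv : ContinuousOn (fun s => T s (f (t - s))) (Icc 0 t) :=
    continuousOn_semigroup_comp hTc hTe continuousOn_id
      (hf.comp (by fun_prop) fun s hs => ⟨sub_nonneg.2 hs.2, by linarith [hs.1, ht.2]⟩)
      fun s hs => hs.1
  rw [← intervalIntegral.integral_add_adjacent_intervals
    (intervalIntegrable_dual φ ht.1 (hcont.mono (Icc_subset_Icc_right ht.2)))
    (intervalIntegrable_dual φ ht.2 (hcont.mono (Icc_subset_Icc_left ht.1))), e1, add_zero,
    map_sub, hv φ, hw φ, e2, ← intervalIntegral.integral_sub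
      (intervalIntegrable_dual φ ht.1 hconv)
      (intervalIntegrable_dual φ ht.1 (hTc.continuousOn_Icc _ le_rfl))]
  refine intervalIntegral.integral_congr fun s hs => ?_
  rw [uIcc_of_le ht.1] at hs
  have : max 0 (min r (t - s)) = t - s := by
    rw [min_eq_right (by linarith [hs.1, ht.2]), max_eq_right (sub_nonneg.2 hs.2)]
  simp [F, this]

/-- Orbits of a semigroup of bounded semivariation lie in the domain of the generator at positive
times. -/
theorem exists_generatorPair_orbit [ContinuousSMul ℝ X] (hX : IsSeqComplete X) (hr : 0 < r)
    (hT : IsSemigroup T) (hTc : IsStronglyContinuous T) (hTe : IsLocallyEquicontinuous T)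
    (hsv : IsBoundedSemivariation T 0 r) (x : X) :
    ∃ z : ℝ → X, ContinuousOn z (Ioc 0 r) ∧ ∀ t ∈ Ioc 0 r, IsGeneratorPair T (T t x) (z t) := by
  obtain ⟨z, hz, hzv⟩ := exists_generatorPair_convolution hX hr hT hTc hTe hsv
    (hTc.continuousOn_Icc x le_rfl)
  refine ⟨fun t => t⁻¹ • z t, (continuousOn_id.inv₀ fun t ht => ht.1.ne').smul
    (hz.mono Ioc_subset_Icc_self), fun t ht => ?_⟩
  -- The integrand `T(t - s)T(s)x = T(t)x` is constant, so the convolution is `t • T t x`.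
  have h := (hzv t (Ioc_subset_Icc_self ht) (t • T t x) fun φ => ?_).real_smul t⁻¹
  · rwa [inv_smul_smul₀ ht.1.ne'] at h
  · have : ∀ s ∈ uIcc 0 t, φ (T (t - s) (T s x)) = φ (T t x) := by
      intro s hs
      rw [uIcc_of_le ht.1.le] at hs
      have h1 := hT.add s (t - s) hs.1 (sub_nonneg.2 hs.2)
      rw [sub_add_cancel] at h1
      rw [h1]
      rfl
    rw [intervalIntegral.integral_congr (g := fun _ => φ (T t x)) this]
    simp

/-- Integrated increments of a mild solution. -/
theorem hasWeakIntegral_mild_sub (hT : IsSemigroup T) (hTc : IsStronglyContinuous T)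
    (hTe : IsLocallyEquicontinuous T) {f : ℝ → X} (hf : ContinuousOn f (Icc 0 r)) {x Z : X}
    {I : ℝ → X}
    (hI : ∀ t ∈ Icc 0 r, HasWeakIntegral (fun s => T (t - s) (f s)) 0 t (I t))
    {s t : ℝ} (hs : 0 ≤ s) (hst : s ≤ t) (ht : t ≤ r)
    (hZ : IsGeneratorPair T (T s x + I s) Z) :
    HasWeakIntegral (fun σ => T (t - σ) (Z + f σ)) s t ((T t x + I t) - (T s x + I s)) := by
  intro φ
  have hts := sub_nonneg.2 hst
  have hint : ∀ t' ≤ t, ∀ a b, 0 ≤ a → a ≤ b → b ≤ t' → IntervalIntegrable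
      (fun σ => φ (T (t' - σ) (f σ))) MeasureTheory.volume a b := fun t' ht' a b ha hab hb =>
    intervalIntegrable_dual φ hab (continuousOn_semigroup_comp hTc hTe (by fun_prop)
      (hf.mono (Icc_subset_Icc ha (hb.trans (ht'.trans ht)))) fun σ hσ =>
        sub_nonneg.2 (hσ.2.trans hb))
  -- Restart at time `s`: the integral up to `s` is transported by `T(t - s)`.
  have e1 : φ (I t) = φ (T (t - s) (I s)) + ∫ σ in s..t, φ (T (t - σ) (f σ)) := by
    rw [hI t ⟨hs.trans hst, ht⟩ φ, ← intervalIntegral.integral_add_adjacent_intervals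
      (hint t le_rfl 0 s le_rfl hs hst) (hint t le_rfl s t hs hst le_rfl)]
    congr 1
    refine ((hI s ⟨hs, hst.trans ht⟩ (dualComp φ (T (t - s)))).trans
      (intervalIntegral.integral_congr fun σ hσ => ?_)).symm
    rw [uIcc_of_le hs] at hσ
    have h1 := hT.add (s - σ) (t - s) (sub_nonneg.2 hσ.2) hts
    rw [sub_add_sub_cancel] at h1
    simp only [h1]
    rfl
  have e2 : T t x = T (t - s) (T s x) := by
    have h1 := hT.add s (t - s) hs hts
    rw [sub_add_cancel] at h1
    rw [h1]
    rfl
  -- The pair relation writes `T(t - s)u(s) - u(s)` as an integral of `T(σ)Z`, which `e4` reflects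
  -- onto `[s, t]`.
  have e3 := hZ (t - s) hts φ
  have e4 : ∫ σ in s..t, φ (T (t - σ) Z) = ∫ σ in 0..t - s, φ (T σ Z) := by
    have := intervalIntegral.integral_comp_sub_left (a := s) (b := t) (fun σ => φ (T σ Z)) t
    rwa [sub_self] at this
  have e5 : ∫ σ in s..t, φ (T (t - σ) (Z + f σ)) =
      (∫ σ in s..t, φ (T (t - σ) Z)) + ∫ σ in s..t, φ (T (t - σ) (f σ)) := by
    rw [← intervalIntegral.integral_add _ (hint t le_rfl s t hs hst le_rfl)]
    · simp only [map_add]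
    · exact intervalIntegrable_dual φ hst (continuousOn_semigroup_comp hTc hTe (by fun_prop)
        continuousOn_const fun σ hσ => sub_nonneg.2 hσ.2)
  rw [e5, e4, ← e3]
  simp only [map_sub, map_add] at e1 ⊢
  rw [e1, e2]
  ring

end Convolution

end LCSemigroup

theorem mainTheorem9 {𝕜 X : Type*} [RCLike 𝕜] [AddCommGroup X] [Module 𝕜 X] [Module ℝ X]
    [IsScalarTower ℝ 𝕜 X] [UniformSpace X] [IsUniformAddGroup X] [ContinuousSMul 𝕜 X]
    [ContinuousSMul ℝ X] [PolynormableSpace 𝕜 X] [T2Space X]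
    (hX : LCSemigroup.IsSeqComplete X)
    (T : ℝ → X →L[𝕜] X) (hT : LCSemigroup.IsSemigroup T)
    (hTc : LCSemigroup.IsStronglyContinuous T) (hTe : LCSemigroup.IsLocallyEquicontinuous T)
    (r : ℝ) (hr : 0 < r) (hsv : LCSemigroup.IsBoundedSemivariation T 0 r)
    (f : ℝ → X) (hf : ContinuousOn f (Set.Icc 0 r)) (x : X) :
    (∀ t ∈ Set.Icc 0 r, LCSemigroup.RiemannIntegrable (fun s => T (t - s) (f s)) 0 t) ∧
      LCSemigroup.IsClassicalSolution (LCSemigroup.generator T) r f x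
        (LCSemigroup.mildSolution T f x) := by
  open LCSemigroup in
  have hcont : ∀ t ∈ Icc 0 r, ContinuousOn (fun s => T (t - s) (f s)) (Icc 0 t) := fun t ht =>
    continuousOn_semigroup_comp hTc hTe (by fun_prop) (hf.mono (Icc_subset_Icc_right ht.2))
      fun s hs => sub_nonneg.2 hs.2
  let I : ℝ → X := fun t => riemannIntegral (fun s => T (t - s) (f s)) 0 t
  have hI : ∀ t ∈ Icc 0 r, HasWeakIntegral (fun s => T (t - s) (f s)) 0 t (I t) := fun t ht => by
    obtain ⟨y, hy⟩ := exists_hasWeakIntegral 𝕜 hX ht.1 (hcont t ht)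
    have : I t = y := hy.riemannIntegral_eq 𝕜 ht.1 (hcont t ht)
    rwa [this]
  refine ⟨fun t ht => ⟨I t, (hI t ht).hasRiemannIntegral 𝕜 (hcont t ht) ht.1⟩, ?_⟩
  obtain ⟨z, hz, hzI⟩ := exists_generatorPair_convolution hX hr hT hTc hTe hsv hf
  obtain ⟨zx, hzx, hzxT⟩ := exists_generatorPair_orbit hX hr hT hTc hTe hsv x
  have hIG : ∀ t ∈ Icc 0 r, IsGeneratorPair T (I t) (z t) := fun t ht => hzI t ht _ (hI t ht)
  -- For initial value `0` the generator term `z` is continuous up to `t = 0`, so `I` is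
  -- differentiable on all of `[0, r]`. The orbit part has such control only for `t > 0`.
  have hIc : ContinuousOn I (Icc 0 r) := fun t ht =>
    (hasDerivWithinAt_of_hasWeakIntegral hT hTc hTe ordConnected_Icc hz hf
      (fun s hs t ht hst => by
        have := hasWeakIntegral_mild_sub (x := 0) hT hTc hTe hf hI hs.1 hst ht.2
          (by simpa using hIG s hs)
        simpa using this) ht).hasFDerivWithinAt.continuousWithinAt
  have huG : ∀ t ∈ Ioc 0 r, IsGeneratorPair T (T t x + I t) (zx t + z t) := fun t ht =>
    (hzxT t ht).add hTc (hIG t (Ioc_subset_Icc_self ht))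
  have hZ : ContinuousOn (fun t => zx t + z t) (Ioc 0 r) := hzx.add (hz.mono Ioc_subset_Icc_self)
  have hf' := hf.mono Ioc_subset_Icc_self
  have hI0 : I 0 = 0 := eq_of_forall_dual_eq 𝕜 fun φ => by
    rw [hI 0 (left_mem_Icc.2 hr.le) φ, intervalIntegral.integral_same, map_zero]
  refine ⟨(hTc.continuousOn_Icc x le_rfl).add hIc, ?_, fun t => zx t + z t + f t, hZ.add hf',
    fun t ht => ⟨?_, ?_⟩⟩
  · change T 0 x + I 0 = x
    rw [hI0, hT.zero, add_zero]
    rfl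
  · exact hasDerivWithinAt_of_hasWeakIntegral hT hTc hTe ordConnected_Ioc hZ hf'
      (fun s hs t ht hst => hasWeakIntegral_mild_sub hT hTc hTe hf hI hs.1.le hst ht.2
        (huG s hs)) ht
  · have hd : HasOrbitDeriv T (mildSolution T f x t) (zx t + z t) :=
      (huG t ht).hasOrbitDeriv hT hTc
    refine ⟨mem_generator_domain.2 ⟨_, hd⟩, ?_⟩
    exact congrArg (· + f t) (hd.unique (hasOrbitDeriv_generator ⟨_, _⟩))
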